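/- Let $m \ge 2$ and let $A_m = \mathbb{Z}_m = \{0,1,\dots,m-1\}$, ordered by $0<1<\dots<m-1$. Order $A_m^{\mathbb{N}}$ lexicographically, and give it the product topology of the discrete topology on $A_m$. Let $\varphi_m$ be the substitution $\varphi_m(k) = k\,(k+1)$, $k \in \mathbb{Z}_m$ (addition modulo $m$), and for $i \in A_m$ let $w_i = \varphi_m^\infty(i) \in A_m^{\mathbb{N}}$ be the infinite word that has all the words $\varphi_m^n(i)$, $n \ge 0$, as prefixes. Let $L_m \subseteq A_m^{\mathbb{N}}$ be the Thue–Morse subshift, i.e. the closure of the orbit of the generalized Thue–Morse sequence $t_m = w_0$ under the shift map. Two words $w<w'$ of $L_m$ are called consecutive if no $w'' \in L_m$ satisfies $w<w''<w'$. Then the words $w_0,\dots,w_{m-1}$ belong to $L_m$ and are infinite left special words of $L_m$: every prefix $v$ of $w_i$ is a factor of $L_m$ for which there are at least two letters $a \in A_m$ such that $av$ is a factor of $L_m$. Among them: 1. $(w_{m-2}, w_{m-1})$ is a pair of consecutive words of $L_m$, with $w_{m-2}<w_{m-1}$. 2. If $m>2$, then none of the words $w_0,\dots,w_{m-3}$ belongs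 to a pair of consecutive words of $L_m$; moreover each of them is the limit of a strictly increasing sequence of words of $L_m$ and also the limit of a strictly decreasing sequence of words of $L_m$. -/

import Mathlib

/-!
Infinite words over an alphabet `A` are functions `ℕ → A`, with the product topology of the
discrete topology (the topology of the Cantor metric) and the lexicographic order, which is
Mathlib's order on `Lex (ℕ → A)`.  Finite words are lists.  The alphabet `ℤ_m = {0, …, m-1}` is
`Fin m`, with its natural order and addition modulo `m`.
-/

namespace GenThueMorse

section Words

variable {A : Type*}

/-- The factor of length `n` of the infinite word `w` that starts at position `k`. -/
def block (w : ℕ → A) (k n : ℕ) : List A := (List.range n).map fun j => w (k + j)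

/-- `Fact_L`: the finite words that occur in some word of `L`. -/
def Fact (L : Set (ℕ → A)) : Set (List A) :=
  {v | ∃ w ∈ L, ∃ k, block w k v.length = v}

/-- The shift map, which erases the first letter. -/
def shift (w : ℕ → A) : ℕ → A := fun n => w (n + 1)

/-- The subshift induced by `w`: the closure of the orbit of `w` under the shift. -/
def inducedSubshift [TopologicalSpace A] (w : ℕ → A) : Set (ℕ → A) :=
  closure (Set.range fun n : ℕ => shift^[n] w)

/-- `v` is a left special factor of `L`: it has at least two distinct left letter extensions
in `Fact_L`. -/
def IsLeftSpecial (L : Set (ℕ → A)) (v : List A) : Prop :=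
  v ∈ Fact L ∧ ∃ a b : A, a ≠ b ∧ a :: v ∈ Fact L ∧ b :: v ∈ Fact L

/-- `SP_L`: the infinite words all of whose prefixes are left special factors of `L`. -/
def SP (L : Set (ℕ → A)) : Set (ℕ → A) :=
  {w | ∀ n, IsLeftSpecial L (block w 0 n)}

/-- The pairs `(w, w')` of consecutive words of `L`: `w < w'` in the lexicographic order and no
word of `L` lies strictly between them. -/
def ConsecPair [LinearOrder A] (L : Set (ℕ → A)) : Set ((ℕ → A) × (ℕ → A)) :=
  {p | p.1 ∈ L ∧ p.2 ∈ L ∧ toLex p.1 < toLex p.2 ∧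
    ¬ ∃ u ∈ L, toLex p.1 < toLex u ∧ toLex u < toLex p.2}

/-- The words that belong to some pair of consecutive words of `L`. -/
def Consec [LinearOrder A] (L : Set (ℕ → A)) : Set (ℕ → A) :=
  {w | ∃ w', (w, w') ∈ ConsecPair L ∨ (w', w) ∈ ConsecPair L}

/-- `w` is the limit of a (strictly) increasing sequence of words of `L`. -/
def IsLimitOfIncreasing [LinearOrder A] [TopologicalSpace A] (L : Set (ℕ → A)) (w : ℕ → A) :
    Prop :=
  ∃ u : ℕ → ℕ → A, (∀ n, u n ∈ L) ∧ StrictMono (fun n => toLex (u n)) ∧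
    Filter.Tendsto u Filter.atTop (nhds w)

/-- `w` is the limit of a (strictly) decreasing sequence of words of `L`. -/
def IsLimitOfDecreasing [LinearOrder A] [TopologicalSpace A] (L : Set (ℕ → A)) (w : ℕ → A) :
    Prop :=
  ∃ u : ℕ → ℕ → A, (∀ n, u n ∈ L) ∧ StrictAnti (fun n => toLex (u n)) ∧
    Filter.Tendsto u Filter.atTop (nhds w)

end Words

section ThueMorse

variable {m : ℕ} [NeZero m]

/-- The substitution `φ_m : k ↦ k (k+1)` on letters. -/
def phiLetter (k : Fin m) : List (Fin m) := [k, k + 1]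

/-- The substitution `φ_m` extended to finite words as a morphism. -/
def phi (v : List (Fin m)) : List (Fin m) := v.flatMap phiLetter

theorem length_phi (v : List (Fin m)) : (phi v).length = 2 * v.length := by
  induction v with
  | nil => rfl
  | cons a v ih =>
    have h : phi (a :: v) = phiLetter a ++ phi v := rfl
    rw [h, List.length_append, ih]
    simp [phiLetter]
    ring

theorem length_phi_iterate (n : ℕ) (v : List (Fin m)) :
    (phi^[n] v).length = 2 ^ n * v.length := by
  induction n with
  | zero => simp
  | succ n ih => rw [Function.iterate_succ_apply', length_phi, ih]; ring

/-- The infinite word `φ_m^∞(i)`: its letter at position `n` is that of the finite word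
`φ_m^n(i)`, which has length `2 ^ n > n`. See `prefix_phiInfty`: all the `φ_m^n(i)` are
prefixes of it. -/
def phiInfty (i : Fin m) : ℕ → Fin m := fun n =>
  (phi^[n] [i])[n]'(by rw [length_phi_iterate]; simpa using n.lt_two_pow_self)

theorem phi_append (u v : List (Fin m)) : phi (u ++ v) = phi u ++ phi v := by
  simp [phi]

theorem phi_iterate_prefix_succ (i : Fin m) (n : ℕ) :
    phi^[n] [i] <+: phi^[n + 1] [i] := by
  induction n with
  | zero => exact ⟨[i + 1], rfl⟩
  | succ n ih =>
    obtain ⟨t, ht⟩ := ih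
    refine ⟨phi t, ?_⟩
    rw [Function.iterate_succ_apply' phi (n + 1), Function.iterate_succ_apply' phi n,
      ← phi_append, ht, Function.iterate_succ_apply' phi n]

theorem phi_iterate_prefix (i : Fin m) {n k : ℕ} (h : n ≤ k) :
    phi^[n] [i] <+: phi^[k] [i] := by
  induction k, h using Nat.le_induction with
  | base => exact List.prefix_rfl
  | succ k _ ih => exact ih.trans (phi_iterate_prefix_succ i k)

/-- Every `φ_m^n(i)` is a prefix of `φ_m^∞(i)`. -/
theorem prefix_phiInfty (i : Fin m) (n : ℕ) :
    block (phiInfty i) 0 (2 ^ n) = phi^[n] [i] := by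
  apply List.ext_getElem
  · simp [block, length_phi_iterate]
  · intro j h1 h2
    simp only [block, List.getElem_map, List.getElem_range, phiInfty, Nat.zero_add]
    rcases le_total j n with h | h
    · exact (phi_iterate_prefix i h).getElem _
    · exact ((phi_iterate_prefix i h).getElem h2).symm

/-- The Thue-Morse subshift `L_m`, induced by the generalized Thue-Morse sequence
`t_m = φ_m^∞(0)`. -/
def thueMorseSubshift (m : ℕ) [NeZero m] : Set (ℕ → Fin m) :=
  inducedSubshift (phiInfty (0 : Fin m))

end ThueMorse

end GenThueMorse

/-! Every two-letter word `a b` occurs in `t_m`, so some word `u` of `L_m` begins with it. Then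
`φ_m^n(u)` lies in `L_m`, agrees with `w_a` below `2 ^ n`, and has `b` at position `2 ^ n`, where
`w_a` has `a + 1`. For `a = i ≤ m - 3`, the choices `b = i` and `b = i + 2` give approximations of
`w_i` from below and above (`exists_approx`). Since `φ_m^n(a)` ends in `a + n`, the same words show
that every letter extends every prefix of `w_i` to the left.

For consecutiveness, `w_{m-2}` is the largest word of `L_m` beginning with `m - 2`, and `w_{m-1}`
the smallest beginning with `m - 1`. Both follow by descent: a counterexample desubstitutes to one
whose first difference comes at half the position (`not_gt_phiInfty`, `not_lt_phiInfty`). -/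

namespace GenThueMorse

/-! ### Convergence and strict approximation in the lexicographic order -/

section Limits

variable {A : Type*}

/-- A sequence of words whose `n`-th term agrees with `w` below position `2 ^ n` converges
to `w`. -/
theorem tendsto_of_eq_below_two_pow [TopologicalSpace A] {u : ℕ → ℕ → A} {w : ℕ → A}
    (h : ∀ n, ∀ j < 2 ^ n, u n j = w j) :
    Filter.Tendsto u Filter.atTop (nhds w) := by
  rw [tendsto_pi_nhds]
  intro j
  refine tendsto_const_nhds.congr' ?_
  filter_upwards [Filter.eventually_ge_atTop j] with n hn
  exact (h n j (hn.trans_lt n.lt_two_pow_self)).symm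

end Limits

section Order

variable {A : Type*} [LinearOrder A]

theorem toLex_lt_iff {u v : ℕ → A} :
    toLex u < toLex v ↔ ∃ d, (∀ j < d, u j = v j) ∧ u d < v d := Iff.rfl

theorem strictMono_of_eq_below_two_pow {u : ℕ → ℕ → A} {w : ℕ → A}
    (h : ∀ n, ∀ j < 2 ^ n, u n j = w j) (hlt : ∀ n, u n (2 ^ n) < w (2 ^ n)) :
    StrictMono fun n => toLex (u n) := by
  refine strictMono_nat_of_lt_succ fun n => toLex_lt_iff.2 ⟨2 ^ n, fun j hj => ?_, ?_⟩
  · rw [h n j hj, h (n + 1) j (hj.trans (Nat.pow_lt_pow_succ one_lt_two))]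
  · rw [h (n + 1) _ (Nat.pow_lt_pow_succ one_lt_two)]
    exact hlt n

theorem strictAnti_of_eq_below_two_pow {u : ℕ → ℕ → A} {w : ℕ → A}
    (h : ∀ n, ∀ j < 2 ^ n, u n j = w j) (hlt : ∀ n, w (2 ^ n) < u n (2 ^ n)) :
    StrictAnti fun n => toLex (u n) := by
  refine strictAnti_nat_of_succ_lt fun n => toLex_lt_iff.2 ⟨2 ^ n, fun j hj => ?_, ?_⟩
  · rw [h n j hj, h (n + 1) j (hj.trans (Nat.pow_lt_pow_succ one_lt_two))]
  · rw [h (n + 1) _ (Nat.pow_lt_pow_succ one_lt_two)]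
    exact hlt n

/-- A word approximated strictly from both sides belongs to no pair of consecutive words. -/
theorem notMem_consec {L : Set (ℕ → A)} {u v : ℕ → ℕ → A} {w : ℕ → A}
    (hu : ∀ n, u n ∈ L) (hv : ∀ n, v n ∈ L)
    (hue : ∀ n, ∀ j < 2 ^ n, u n j = w j) (hve : ∀ n, ∀ j < 2 ^ n, v n j = w j)
    (hlt : ∀ n, u n (2 ^ n) < w (2 ^ n)) (hgt : ∀ n, w (2 ^ n) < v n (2 ^ n)) :
    w ∉ Consec L := by
  rintro ⟨w', ⟨-, -, h, hno⟩ | ⟨-, -, h, hno⟩⟩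
  · obtain ⟨d, hd, hlt'⟩ := toLex_lt_iff.1 h
    -- Since `d < 2 ^ d`, the word `v d` agrees with `w` through position `d`, hence compares with
    -- `w'` as `w` does.
    refine hno ⟨v d, hv d, toLex_lt_iff.2 ⟨2 ^ d, fun j hj => (hve d j hj).symm, hgt d⟩,
      toLex_lt_iff.2 ⟨d, fun j hj => ?_, ?_⟩⟩
    · exact (hve d j (hj.trans d.lt_two_pow_self)).trans (hd j hj)
    · exact (hve d d d.lt_two_pow_self).trans_lt hlt'
  · obtain ⟨d, hd, hlt'⟩ := toLex_lt_iff.1 h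
    refine hno ⟨u d, hu d, toLex_lt_iff.2 ⟨d, fun j hj => ?_, ?_⟩,
      toLex_lt_iff.2 ⟨2 ^ d, fun j hj => hue d j hj, hlt d⟩⟩
    · exact (hd j hj).trans (hue d j (hj.trans d.lt_two_pow_self)).symm
    · exact hlt'.trans_eq (hue d d d.lt_two_pow_self).symm

end Order

/-! ### Membership in a subshift through prefixes -/

section Subshift

variable {A : Type*}

theorem shift_iterate_apply (w : ℕ → A) (k j : ℕ) : (shift^[k] w) j = w (k + j) := by
  induction k generalizing w with
  | zero => simp
  | succ k ih =>
    rw [Function.iterate_succ_apply, ih]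
    exact congrArg w (by omega)

/-- A word belongs to the subshift induced by `w` iff its prefixes occur in `w`. -/
theorem mem_inducedSubshift_iff [TopologicalSpace A] [DiscreteTopology A] {w u : ℕ → A} :
    u ∈ inducedSubshift w ↔ ∀ n, ∃ k, ∀ j < n, u j = w (k + j) := by
  rw [inducedSubshift, mem_closure_iff_nhds]
  constructor
  · intro h n
    have hs : (Set.Iio n).pi (fun j => ({u j} : Set A)) ∈ nhds u :=
      set_pi_mem_nhds (Set.finite_Iio n) fun j _ => by simp
    obtain ⟨_, hv, k, rfl⟩ := h _ hs
    refine ⟨k, fun j hj => ?_⟩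
    have : (shift^[k] w) j = u j := hv j hj
    exact this.symm.trans (shift_iterate_apply w k j)
  · intro h s hs
    choose k hk using h
    have ht : Filter.Tendsto (fun n => shift^[k n] w) Filter.atTop (nhds u) := by
      rw [tendsto_pi_nhds]
      intro j
      refine tendsto_const_nhds.congr' ?_
      filter_upwards [Filter.eventually_gt_atTop j] with n hn
      rw [shift_iterate_apply]
      exact hk n j hn
    obtain ⟨n, hn⟩ := (ht.eventually_mem hs).exists
    exact ⟨_, hn, k n, rfl⟩

theorem block_mem_fact {L : Set (ℕ → A)} {w : ℕ → A} (hw : w ∈ L) (k n : ℕ) :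
    block w k n ∈ Fact L :=
  ⟨w, hw, k, by simp [block]⟩

theorem block_succ (w : ℕ → A) (k n : ℕ) : block w k (n + 1) = w k :: block w (k + 1) n := by
  simp only [block, List.range_succ_eq_map, List.map_cons, List.map_map, Nat.add_zero]
  congr 1
  refine List.map_congr_left fun j _ => ?_
  exact congrArg w (by simp; omega)

theorem block_congr {u w : ℕ → A} {k l n : ℕ} (h : ∀ j < n, u (k + j) = w (l + j)) :
    block u k n = block w l n :=
  List.map_congr_left fun j hj => h j (List.mem_range.1 hj)

end Subshift

/-! ### The substitution on letters, finite words and infinite words -/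

section ThueMorse

variable {m : ℕ} [NeZero m]

theorem phi_cons (a : Fin m) (v : List (Fin m)) : phi (a :: v) = a :: (a + 1) :: phi v := rfl

theorem getElem?_phi_two_mul (v : List (Fin m)) (n : ℕ) : (phi v)[2 * n]? = v[n]? := by
  induction v generalizing n with
  | nil => simp [phi]
  | cons a v ih =>
    cases n with
    | zero => simp [phi_cons]
    | succ n => simpa [phi_cons, Nat.mul_succ] using ih n

theorem getElem?_phi_two_mul_add_one (v : List (Fin m)) (n : ℕ) :
    (phi v)[2 * n + 1]? = v[n]?.map (· + 1) := by
  induction v generalizing n with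
  | nil => simp [phi]
  | cons a v ih =>
    cases n with
    | zero => simp [phi_cons]
    | succ n => simpa [phi_cons, Nat.mul_succ] using ih n

theorem getElem?_phi_iterate (i : Fin m) {n j : ℕ} (h : j < 2 ^ n) :
    (phi^[n] [i])[j]? = some (phiInfty i j) := by
  rw [← prefix_phiInfty]
  simp [block, h]

@[simp] theorem phiInfty_zero (i : Fin m) : phiInfty i 0 = i := rfl

@[simp] theorem phiInfty_two_mul (i : Fin m) (n : ℕ) : phiInfty i (2 * n) = phiInfty i n := by
  have h : n < 2 ^ n := n.lt_two_pow_self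
  apply Option.some_injective
  rw [← getElem?_phi_iterate i h, ← getElem?_phi_iterate i (n := n + 1) (by omega),
    Function.iterate_succ_apply', getElem?_phi_two_mul]

@[simp] theorem phiInfty_two_mul_add_one (i : Fin m) (n : ℕ) :
    phiInfty i (2 * n + 1) = phiInfty i n + 1 := by
  have h : n < 2 ^ n := n.lt_two_pow_self
  apply Option.some_injective
  rw [← getElem?_phi_iterate i (n := n + 1) (by omega), Function.iterate_succ_apply',
    getElem?_phi_two_mul_add_one, getElem?_phi_iterate i h, Option.map_some]

@[simp] theorem phiInfty_one (i : Fin m) : phiInfty i 1 = i + 1 :=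
  phiInfty_two_mul_add_one i 0

@[simp] theorem phiInfty_two (i : Fin m) : phiInfty i 2 = i + 1 :=
  (phiInfty_two_mul i 1).trans (phiInfty_one i)

theorem phiInfty_two_pow (i : Fin m) (n : ℕ) : phiInfty i (2 ^ n) = i + 1 := by
  induction n with
  | zero => simp
  | succ n ih => rw [pow_succ', phiInfty_two_mul, ih]

/-- This is the last letter of `φ_m^n(i)`: each substitution adds one to the last letter. -/
theorem phiInfty_two_pow_sub_one (i : Fin m) (n : ℕ) :
    phiInfty i (2 ^ n - 1) = i + n • (1 : Fin m) := by
  induction n with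
  | zero => simp
  | succ n ih =>
    have h : 2 ^ (n + 1) - 1 = 2 * (2 ^ n - 1) + 1 := by
      have := Nat.one_le_two_pow (n := n)
      omega
    rw [h, phiInfty_two_mul_add_one, ih, succ_nsmul, add_assoc]

/-- The substitution `φ_m` extended to infinite words. -/
def phiWord (u : ℕ → Fin m) : ℕ → Fin m := fun n => if n % 2 = 0 then u (n / 2) else u (n / 2) + 1

@[simp] theorem phiWord_two_mul (u : ℕ → Fin m) (n : ℕ) : phiWord u (2 * n) = u n := by
  simp [phiWord]

@[simp] theorem phiWord_two_mul_add_one (u : ℕ → Fin m) (n : ℕ) :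
    phiWord u (2 * n + 1) = u n + 1 := by
  have h1 : (2 * n + 1) / 2 = n := by omega
  simp [phiWord, h1]

/-- The `k`-th aligned block of length `2 ^ n` in `φ_m^n(u)` is `φ_m^n(u k)`, a prefix of `w_{u k}`.
-/
theorem phiWord_iterate_apply (u : ℕ → Fin m) (n k : ℕ) {j : ℕ} (hj : j < 2 ^ n) :
    (phiWord^[n] u) (2 ^ n * k + j) = phiInfty (u k) j := by
  induction n generalizing j with
  | zero =>
    obtain rfl : j = 0 := by simpa using hj
    simp
  | succ n ih =>
    rw [Function.iterate_succ_apply']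
    rcases Nat.even_or_odd' j with ⟨l, rfl | rfl⟩
    · rw [show 2 ^ (n + 1) * k + 2 * l = 2 * (2 ^ n * k + l) by ring, phiWord_two_mul,
        phiInfty_two_mul, ih (by omega)]
    · rw [show 2 ^ (n + 1) * k + (2 * l + 1) = 2 * (2 ^ n * k + l) + 1 by ring,
        phiWord_two_mul_add_one, phiInfty_two_mul_add_one, ih (by omega)]

theorem phiWord_iterate_apply_of_lt (u : ℕ → Fin m) {n j : ℕ} (hj : j < 2 ^ n) :
    (phiWord^[n] u) j = phiInfty (u 0) j := by
  simpa using phiWord_iterate_apply u n 0 hj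

theorem phiWord_iterate_two_pow (u : ℕ → Fin m) (n : ℕ) : (phiWord^[n] u) (2 ^ n) = u 1 := by
  simpa using phiWord_iterate_apply u n 1 (Nat.two_pow_pos n)

theorem mem_thueMorseSubshift_iff {u : ℕ → Fin m} :
    u ∈ thueMorseSubshift m ↔ ∀ n, ∃ k, ∀ j < n, u j = phiInfty 0 (k + j) :=
  mem_inducedSubshift_iff

theorem phiWord_mem {u : ℕ → Fin m} (hu : u ∈ thueMorseSubshift m) :
    phiWord u ∈ thueMorseSubshift m := by
  rw [mem_thueMorseSubshift_iff] at hu ⊢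
  intro n
  obtain ⟨k, hk⟩ := hu n
  refine ⟨2 * k, fun j hj => ?_⟩
  rcases Nat.even_or_odd' j with ⟨l, rfl | rfl⟩
  · rw [phiWord_two_mul, ← mul_add, phiInfty_two_mul, hk l (by omega)]
  · rw [phiWord_two_mul_add_one, ← add_assoc, ← mul_add, phiInfty_two_mul_add_one,
      hk l (by omega)]

theorem phiWord_iterate_mem {u : ℕ → Fin m} (hu : u ∈ thueMorseSubshift m) (n : ℕ) :
    phiWord^[n] u ∈ thueMorseSubshift m := by
  induction n with
  | zero => exact hu
  | succ n ih =>
    rw [Function.iterate_succ_apply']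
    exact phiWord_mem ih

/-- Desubstitution: a word of the subshift is cut into blocks `k (k+1)` either at the even or at
the odd positions, and in the first case it is the image of a word of the subshift. -/
theorem desubstitution {u : ℕ → Fin m} (hu : u ∈ thueMorseSubshift m) :
    ((∀ n, u (2 * n + 1) = u (2 * n) + 1) ∧ (fun n => u (2 * n)) ∈ thueMorseSubshift m) ∨
      ∀ n, u (2 * n + 2) = u (2 * n + 1) + 1 := by
  rw [mem_thueMorseSubshift_iff] at hu
  -- Either every prefix of `u` occurs at an even position, or some prefix does not, and then all
  -- longer ones occur only at odd positions.
  by_cases h : ∀ n, ∃ k, ∀ j < n, u j = phiInfty 0 (2 * k + j)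
  · refine Or.inl ⟨fun n => ?_, mem_thueMorseSubshift_iff.2 fun n => ?_⟩
    · obtain ⟨k, hk⟩ := h (2 * n + 2)
      rw [hk _ (by omega), hk (2 * n) (by omega), ← add_assoc, ← mul_add,
        phiInfty_two_mul_add_one, phiInfty_two_mul]
    · obtain ⟨k, hk⟩ := h (2 * n)
      refine ⟨k, fun j hj => ?_⟩
      rw [hk (2 * j) (by omega), ← mul_add, phiInfty_two_mul]
  · right
    push Not at h
    obtain ⟨N, hN⟩ := h
    intro n
    obtain ⟨k, hk⟩ := hu (N + 2 * n + 3)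
    rcases Nat.even_or_odd' k with ⟨l, rfl | rfl⟩
    · obtain ⟨j, hj, hne⟩ := hN l
      exact absurd (hk j (by omega)) hne
    · rw [hk _ (by omega), hk (2 * n + 1) (by omega),
        show 2 * l + 1 + (2 * n + 2) = 2 * (l + n + 1) + 1 by ring,
        show 2 * l + 1 + (2 * n + 1) = 2 * (l + n + 1) by ring,
        phiInfty_two_mul_add_one, phiInfty_two_mul]

open scoped Fin.NatCast Fin.CommRing in
theorem val_nsmul_one (a : Fin m) : (a : ℕ) • (1 : Fin m) = a := by
  rw [nsmul_one, Fin.cast_val_eq_self]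

/-! ### Two-letter factors and left special words -/

/-- Every word of length two occurs in the Thue-Morse sequence. -/
theorem exists_phiInfty_pair (a b : Fin m) :
    ∃ k, phiInfty (0 : Fin m) k = a ∧ phiInfty (0 : Fin m) (k + 1) = b := by
  -- In `φ_m(a b) = a (a+1) b (b+1)` the middle pair is `(a+1) b`: the first letter can be raised by
  -- one while the second is kept.
  have step : ∀ (j k : ℕ), ∃ l, phiInfty (0 : Fin m) l = phiInfty 0 k + j • (1 : Fin m) ∧
      phiInfty (0 : Fin m) (l + 1) = phiInfty 0 (k + 1) := by
    intro j k
    induction j with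
    | zero => exact ⟨k, by simp, rfl⟩
    | succ j ih =>
      obtain ⟨l, h1, h2⟩ := ih
      refine ⟨2 * l + 1, ?_, ?_⟩
      · rw [phiInfty_two_mul_add_one, h1, succ_nsmul, add_assoc]
      · rw [← h2, add_assoc, one_add_one_eq_two, ← Nat.mul_succ, phiInfty_two_mul]
  obtain ⟨k, hk⟩ : ∃ k, phiInfty (0 : Fin m) (k + 1) = b := by
    refine ⟨2 * (2 ^ ((b - 1 : Fin m) : ℕ) - 1), ?_⟩
    rw [phiInfty_two_mul_add_one, phiInfty_two_pow_sub_one, val_nsmul_one]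
    abel
  obtain ⟨l, h1, h2⟩ := step ((a - phiInfty (0 : Fin m) k : Fin m) : ℕ) k
  refine ⟨l, ?_, h2.trans hk⟩
  rw [h1, val_nsmul_one]
  abel

theorem exists_mem_thueMorseSubshift (a b : Fin m) :
    ∃ u ∈ thueMorseSubshift m, u 0 = a ∧ u 1 = b := by
  obtain ⟨k, h0, h1⟩ := exists_phiInfty_pair a b
  exact ⟨fun j => phiInfty 0 (k + j), mem_thueMorseSubshift_iff.2 fun _ => ⟨k, fun _ _ => rfl⟩,
    h0, h1⟩

theorem phiInfty_mem (i : Fin m) : phiInfty i ∈ thueMorseSubshift m := by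
  obtain ⟨u, hu, h0, -⟩ := exists_mem_thueMorseSubshift i i
  rw [mem_thueMorseSubshift_iff]
  intro n
  obtain ⟨k, hk⟩ := mem_thueMorseSubshift_iff.1 (phiWord_iterate_mem hu n) n
  refine ⟨k, fun j hj => ?_⟩
  rw [← hk j hj, phiWord_iterate_apply_of_lt u (hj.trans n.lt_two_pow_self), h0]

/-- Every prefix of `w_i` can be extended to the left by every letter. -/
theorem cons_block_phiInfty_mem_fact (c i : Fin m) (n : ℕ) :
    c :: block (phiInfty i) 0 n ∈ Fact (thueMorseSubshift m) := by
  -- With first letter `c - n`, the block `φ_m^n(c - n)` ends in `c` and is followed by `φ_m^n(i)`.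
  obtain ⟨u, hu, h0, h1⟩ := exists_mem_thueMorseSubshift (c - n • (1 : Fin m)) i
  have hpos := Nat.two_pow_pos n
  have hc : (phiWord^[n] u) (2 ^ n - 1) = c := by
    rw [phiWord_iterate_apply_of_lt u (by omega), phiInfty_two_pow_sub_one, h0]
    abel
  have hb : block (phiWord^[n] u) (2 ^ n) n = block (phiInfty i) 0 n := by
    refine block_congr fun j hj => ?_
    have := phiWord_iterate_apply u n 1 (hj.trans n.lt_two_pow_self)
    rw [zero_add]
    simpa [h1] using this
  have := block_mem_fact (phiWord_iterate_mem hu n) (2 ^ n - 1) (n + 1)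
  rwa [block_succ, hc, Nat.sub_add_cancel hpos, hb] at this

theorem phiInfty_mem_SP (hm : 2 ≤ m) (i : Fin m) : phiInfty i ∈ SP (thueMorseSubshift m) := by
  have : Nontrivial (Fin m) := Fin.nontrivial_iff_two_le.2 hm
  obtain ⟨a, b, hab⟩ := exists_pair_ne (Fin m)
  exact fun n => ⟨block_mem_fact (phiInfty_mem i) 0 n, a, b, hab,
    cons_block_phiInfty_mem_fact a i n, cons_block_phiInfty_mem_fact b i n⟩

/-! ### Extremality of `w_{m-2}` and `w_{m-1}` -/

/-- If a word cut at the even positions first differs from `w_i` at `d`, then `d` is even. -/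
theorem even_of_first_difference {u : ℕ → Fin m} {i : Fin m} {d : ℕ}
    (hcut : ∀ n, u (2 * n + 1) = u (2 * n) + 1) (h : ∀ j < d, u j = phiInfty i j)
    (hd : u d ≠ phiInfty i d) : ∃ l, d = 2 * l := by
  rcases Nat.even_or_odd' d with ⟨l, rfl | rfl⟩
  · exact ⟨l, rfl⟩
  · refine absurd ?_ hd
    rw [hcut, h _ (by omega), phiInfty_two_mul_add_one, phiInfty_two_mul]

/-- `w_i` with `i + 1 = m - 1` is the largest word of the subshift that begins with `i`. -/
theorem not_gt_phiInfty {i : Fin m} (hi : (i : ℕ) + 2 = m) (d : ℕ) :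
    ∀ u ∈ thueMorseSubshift m, u 0 = i → (∀ j < d, u j = phiInfty i j) →
      ¬ phiInfty i d < u d := by
  have h1 : ((i + 1 : Fin m) : ℕ) + 1 = m := by
    rw [Fin.val_add_one_of_lt' (by omega)]
    omega
  induction d using Nat.strong_induction_on with
  | _ d ih =>
    intro u hu h0 hd hlt
    -- `i + 1` is the greatest letter, and it stands at positions 1 and 2 of `w_i`, so `u` cannot
    -- exceed `w_i` there.
    have hle (x : Fin m) : ¬ i + 1 < x := by
      rw [Fin.lt_def]
      omega
    match d with
    | 0 => simp [h0] at hlt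
    | 1 => exact hle _ (by simpa using hlt)
    | 2 => exact hle _ (by simpa using hlt)
    | d + 3 =>
      rcases desubstitution hu with ⟨hcut, hmem⟩ | hcut
      · obtain ⟨l, hl⟩ := even_of_first_difference hcut hd hlt.ne'
        rw [hl] at hlt hd
        -- The preimage of `u` under `φ_m` first exceeds `w_i` at `l`, half of the original
        -- position.
        refine ih l (by omega) _ hmem h0 (fun j hj => ?_) (by simpa using hlt)
        simpa using hd (2 * j) (by omega)
      -- Here `u` begins with `i (i+1) (i+1)`, while a cut at the odd positions would give `u 2 = u
      -- 1 + 1`.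
      · have h2 := hcut 0
        simp only [mul_zero, zero_add] at h2
        rw [hd 2 (by omega), hd 1 (by omega), phiInfty_two, phiInfty_one] at h2
        have h_one : (1 : Fin m) = 0 := by simpa using h2.symm
        rw [Fin.ext_iff, Fin.val_one', Fin.val_zero, Nat.mod_eq_of_lt (by omega)] at h_one
        omega

/-- `w_{m-1}` is the smallest word of the subshift that begins with `m - 1`. -/
theorem not_lt_phiInfty (hm : 2 ≤ m) {i : Fin m} (hi : (i : ℕ) + 1 = m) (d : ℕ) :
    ∀ u ∈ thueMorseSubshift m, u 0 = i → (∀ j < d, u j = phiInfty i j) →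
      ¬ u d < phiInfty i d := by
  have h1 : i + 1 = 0 := by
    rw [Fin.ext_iff, Fin.val_add, Fin.val_one', Fin.val_zero, Nat.add_mod_mod, hi,
      Nat.mod_self]
  induction d using Nat.strong_induction_on with
  | _ d ih =>
    intro u hu h0 hd hlt
    match d with
    | 0 => simp [h0] at hlt
    -- `i + 1 = 0` is the least letter, so `u` cannot fall below `w_i` at positions 1 and 2.
    | 1 => simp [h1] at hlt
    | 2 => simp [h1] at hlt
    | d + 3 =>
      rcases desubstitution hu with ⟨hcut, hmem⟩ | hcut
      · obtain ⟨l, hl⟩ := even_of_first_difference hcut hd hlt.ne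
        rw [hl] at hlt hd
        refine ih l (by omega) _ hmem h0 (fun j hj => ?_) (by simpa using hlt)
        simpa using hd (2 * j) (by omega)
      · have h2 := hcut 0
        simp only [mul_zero, zero_add] at h2
        rw [hd 2 (by omega), hd 1 (by omega), phiInfty_two, phiInfty_one] at h2
        have h_one : (1 : Fin m) = 0 := by simpa using h2.symm
        rw [Fin.ext_iff, Fin.val_one', Fin.val_zero, Nat.mod_eq_of_lt (by omega)] at h_one
        omega

theorem phiInfty_consecPair (hm : 2 ≤ m) {i k : Fin m} (hi : (i : ℕ) + 2 = m)
    (hk : (k : ℕ) + 1 = m) :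
    (phiInfty i, phiInfty k) ∈ ConsecPair (thueMorseSubshift m) := by
  refine ⟨phiInfty_mem i, phiInfty_mem k,
    toLex_lt_iff.2 ⟨0, by simp, ?_⟩, ?_⟩
  · change i < k
    rw [Fin.lt_def]
    omega
  rintro ⟨u, hu, hiu, huk⟩
  obtain ⟨d, hd, hlt⟩ := toLex_lt_iff.1 hiu
  obtain ⟨e, he, hlt'⟩ := toLex_lt_iff.1 huk
  have h0i : i ≤ u 0 := by
    rcases Nat.eq_zero_or_pos d with rfl | h
    · exact hlt.le
    · exact (hd 0 h).le
  have h0k : u 0 ≤ k := by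
    rcases Nat.eq_zero_or_pos e with rfl | h
    · exact hlt'.le
    · exact (he 0 h).le
  rw [Fin.le_def] at h0i h0k
  obtain h | h : u 0 = i ∨ u 0 = k := by
    simp only [Fin.ext_iff]
    omega
  · exact not_gt_phiInfty hi d u hu h (fun j hj => (hd j hj).symm) hlt
  · exact not_lt_phiInfty hm hk e u hu h he hlt'

/-! ### Two-sided approximation of `w_0, …, w_{m-3}` -/

/-- Words of the subshift that first differ from `w_i` at position `2 ^ n`, where they have a
prescribed letter. -/
theorem exists_approx (i b : Fin m) :
    ∃ u : ℕ → ℕ → Fin m, (∀ n, u n ∈ thueMorseSubshift m) ∧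
      (∀ n, ∀ j < 2 ^ n, u n j = phiInfty i j) ∧ ∀ n, u n (2 ^ n) = b := by
  obtain ⟨u, hu, rfl, rfl⟩ := exists_mem_thueMorseSubshift i b
  exact ⟨fun n => phiWord^[n] u, phiWord_iterate_mem hu,
    fun n j hj => phiWord_iterate_apply_of_lt u hj, phiWord_iterate_two_pow u⟩

theorem phiInfty_two_sided_limit {i : Fin m} (hi : (i : ℕ) + 3 ≤ m) :
    phiInfty i ∉ Consec (thueMorseSubshift m) ∧
      IsLimitOfIncreasing (thueMorseSubshift m) (phiInfty i) ∧
      IsLimitOfDecreasing (thueMorseSubshift m) (phiInfty i) := by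
  have h1 : ((i + 1 : Fin m) : ℕ) = i + 1 := Fin.val_add_one_of_lt' (by omega)
  -- The letters `i` and `i + 2` lie on either side of `i + 1`, the letter of `w_i` at `2 ^ n`; `hi`
  -- ensures that `i + 2` does not wrap around.
  obtain ⟨u, hu, hue, hub⟩ := exists_approx i i
  obtain ⟨v, hv, hve, hvb⟩ := exists_approx i (⟨i + 2, by omega⟩ : Fin m)
  have hlt : ∀ n, u n (2 ^ n) < phiInfty i (2 ^ n) := fun n => by
    rw [hub, phiInfty_two_pow, Fin.lt_def]
    omega
  have hgt : ∀ n, phiInfty i (2 ^ n) < v n (2 ^ n) := fun n => by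
    rw [hvb, phiInfty_two_pow, Fin.lt_def, h1]
    exact Nat.lt_succ_self _
  exact ⟨notMem_consec hu hv hue hve hlt hgt,
    ⟨u, hu, strictMono_of_eq_below_two_pow hue hlt, tendsto_of_eq_below_two_pow hue⟩,
    ⟨v, hv, strictAnti_of_eq_below_two_pow hve hgt, tendsto_of_eq_below_two_pow hve⟩⟩

end ThueMorse

end GenThueMorse

theorem mainTheorem4 (m : ℕ) [NeZero m] (hm : 2 ≤ m) :
    (∀ i : Fin m, GenThueMorse.phiInfty i ∈ GenThueMorse.thueMorseSubshift m ∧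
      GenThueMorse.phiInfty i ∈ GenThueMorse.SP (GenThueMorse.thueMorseSubshift m)) ∧
    (GenThueMorse.phiInfty (⟨m - 2, by omega⟩ : Fin m),
      GenThueMorse.phiInfty (⟨m - 1, by omega⟩ : Fin m)) ∈
        GenThueMorse.ConsecPair (GenThueMorse.thueMorseSubshift m) ∧
    (∀ i : Fin m, (i : ℕ) + 3 ≤ m →
      GenThueMorse.phiInfty i ∉ GenThueMorse.Consec (GenThueMorse.thueMorseSubshift m) ∧
      GenThueMorse.IsLimitOfIncreasing (GenThueMorse.thueMorseSubshift m)
        (GenThueMorse.phiInfty i) ∧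
      GenThueMorse.IsLimitOfDecreasing (GenThueMorse.thueMorseSubshift m)
        (GenThueMorse.phiInfty i)) := by
  exact ⟨fun i => ⟨GenThueMorse.phiInfty_mem i, GenThueMorse.phiInfty_mem_SP hm i⟩,
    GenThueMorse.phiInfty_consecPair hm (by simp only; omega) (by simp only; omega),
    fun i hi => GenThueMorse.phiInfty_two_sided_limit hi⟩
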